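/- \textbf{Theorem (existence of an infinite fire).} Consider the following forest-fire process on $\mathbb{Z}_+=\{0,1,2,\dots\}$. Let $\xi_{x,i},\theta_{x,i},\Delta_{x,i}$ ($x\in\mathbb{Z}_+$, $i\ge 1$) be independent random variables, where $\xi_{x,i}\sim\exp(1)$, the burning times $\theta_{x,i}\ge 0$ all have a common distribution $\theta$, and the spreading delays $\Delta_{x,i}\ge 0$ all have a common distribution $\Delta$. All sites are vacant at time $0$. The $i$-th tree at $x$ appears at time $a_{x,i}$, catches fire at time $f_{x,i}\in[a_{x,i},\infty]$ and burns for the time $\theta_{x,i}$, after which the site is vacant again; thus $a_{x,1}=\xi_{x,1}$ and $a_{x,i+1}=f_{x,i}+\theta_{x,i}+\xi_{x,i+1}$. Trees at site $0$ catch fire as soon as they appear: $f_{0,i}=a_{0,i}$. The $i$-th burning of $x$ (if $f_{x,i}<\infty$) stops affecting $x+1$ at time $e_{x,i}=f_{x,i}+\Delta_{x,i}+\theta_{x,i}$, and it can ignite $x+1$ only from time $s_{x,i}=\max\bigl(f_{x,i}+\Delta_{x,i},\ \max_{l<i}e_{x,l}\bigr)$ on, i.e. after its delay has elapsed and all earlier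 burnings of $x$ have stopped affecting $x+1$; if $e_{x,i}\le e_{x,l}$ for some $l<i$ it cannot ignite $x+1$ at all. Otherwise it can ignite the $j$-th tree at $x+1$ if this tree is present, not yet burnt, at time $s_{x,i}$ (i.e. $a_{x+1,j}\le s_{x,i}$) or appears later but before $e_{x,i}$ (i.e. $a_{x+1,j}<e_{x,i}$). The $j$-th tree at $x+1$ is ignited by the first burning $i$ of $x$ that can ignite it, at time $f_{x+1,j}=\max(a_{x+1,j},s_{x,i})$; if there is none, $f_{x+1,j}=\infty$. Fix one of two conventions: either a burning of $x$ may ignite several successive trees at $x+1$ while it affects $x+1$, or it may ignite at most one tree at $x+1$. For $k\ge 1$, fire number $k$ consists of the $k$-th burning of site $0$ and of all burnings caused by it, directly or through a chain of ignitions. Let $n_k\in\mathbb{Z}_+\cup\{\infty\}$ be the right-most site burnt by fire number $k$ (the supremum of the sites burnt by it), and let $\zeta_k\in[0,\infty]$ be its duration, i.e. the supremum of $f_{x,j}-f_{0,k}$ over all burnings $(x,j)$ belonging to it. Fire number $k$ is called \emph{infinite} if $n_k=\infty$ and $\zeta_k=\infty$. Suppose that $\mathbb{P}(\Delta>0)>0$.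 Then, under either convention, almost surely there is an infinite fire; in particular $$\mathbb{P}\bigl(\inf\{k:\ n_k=\infty\}<\infty\bigr)=1 .$$ -/

import Mathlib

open MeasureTheory ProbabilityTheory
open scoped ENNReal NNReal

namespace ForestFire

/-- One realisation of all the random inputs. Trees at a site are numbered `0, 1, 2, …` in order of
appearance, and the `i`-th burning of site `x` is the burning of its `i`-th tree.
* `growth x i` : waiting time, at the empty site `x`, until its `i`-th tree appears;
* `burn x i` : duration of the `i`-th burning of site `x`;
* `delay x i` : time the `i`-th burning of site `x` needs to spread to site `x + 1`. -/
structure Environment where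
  growth : ℕ → ℕ → ℝ≥0
  burn : ℕ → ℕ → ℝ≥0
  delay : ℕ → ℕ → ℝ≥0

/-- The history of one tree: when it catches fire (`⊤` if never), and the number of the burning of
the left neighbour which ignited it (`none` if there is none). -/
structure TreeFate where
  time : ℝ≥0∞
  source : Option ℕ

/-- The burnings of a site as its right neighbour sees them: the `i`-th one starts at time
`time i` (`⊤` if never), lasts for `burn i` and spreads with delay `delay i`. -/
structure Front where
  time : ℕ → ℝ≥0∞
  burn : ℕ → ℝ≥0
  delay : ℕ → ℝ≥0

namespace Front

/-- The time at which the `i`-th burning stops affecting the right neighbour. -/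
noncomputable def cease (F : Front) (i : ℕ) : ℝ≥0∞ :=
  F.time i + F.delay i + F.burn i

/-- The time from which the `i`-th burning can ignite the right neighbour: the delay has elapsed,
and all previous burnings have stopped affecting the right neighbour. -/
noncomputable def start (F : Front) (i : ℕ) : ℝ≥0∞ :=
  max (F.time i + F.delay i) (⨆ j : ℕ, ⨆ _ : j < i, F.cease j)

/-- The `i`-th burning is able to ignite a tree which appears on the right neighbour at time `a`
(and is still there): the burning takes place, it stops affecting the right neighbour strictly later
than all earlier burnings, and the tree is either present at time `F.start i` or appears later but
before time `F.cease i`. -/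
def Reaches (F : Front) (i : ℕ) (a : ℝ≥0∞) : Prop :=
  F.time i ≠ ⊤ ∧ (∀ j < i, F.cease j < F.cease i) ∧ (a ≤ F.start i ∨ a < F.cease i)

open Classical in
/-- The fate of a tree which appears at time `a` to the right of `F` and may be ignited by those
burnings `i` for which `allowed i` holds: it is ignited by the first of them that reaches it, at the
first time at which this burning can do so. -/
noncomputable def fate (F : Front) (allowed : ℕ → Prop) (a : ℝ≥0∞) : TreeFate :=
  if h : ∃ i, allowed i ∧ F.Reaches i a then ⟨max a (F.start (Nat.find h)), some (Nat.find h)⟩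
  else ⟨⊤, none⟩

end Front

/-- The trees at site `0` : each of them starts to burn at the moment at which it appears. -/
noncomputable def originFate (growth burn : ℕ → ℝ≥0) : ℕ → TreeFate
  | 0 => ⟨growth 0, none⟩
  | j + 1 => ⟨(originFate growth burn j).time + burn j + growth (j + 1), none⟩

/-- The trees at a site whose left neighbour burns according to `F`. The first tree appears after
time `growth 0`, each further one after a time `growth (j + 1)` from the end of the previous
burning. If `reignite` is false then a burning of the left neighbour which has ignited a tree cannot
ignite another one; if `reignite` is true then it can, as long as it affects the site. -/
noncomputable def siteFate (reignite : Prop) (F : Front) (growth burn : ℕ → ℝ≥0) : ℕ → TreeFate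
  | 0 => F.fate (fun _ => True) (growth 0)
  | j + 1 =>
    F.fate (fun i => reignite ∨ ∀ i' ∈ (siteFate reignite F growth burn j).source, i' < i)
      ((siteFate reignite F growth burn j).time + burn j + growth (j + 1))

namespace Environment

/-- `E.tree reignite x j` is the fate of the `j`-th tree at site `x`. In particular
`(E.tree reignite x j).time` is the starting time of the `j`-th burning of site `x`. -/
noncomputable def tree (E : Environment) (reignite : Prop) : ℕ → ℕ → TreeFate
  | 0 => originFate (E.growth 0) (E.burn 0)
  | x + 1 =>
    siteFate reignite ⟨fun i => (tree E reignite x i).time, E.burn x, E.delay x⟩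
      (E.growth (x + 1)) (E.burn (x + 1))

/-- The number of the fire to which the `j`-th burning of site `x` belongs (`none` if this burning
does not take place): fire number `k` starts with the `k`-th burning of site `0`, and a burning
belongs to the same fire as the burning of the left neighbour which caused it. -/
noncomputable def fireNumber (E : Environment) (reignite : Prop) : ℕ → ℕ → Option ℕ
  | 0, j => some j
  | x + 1, j => (E.tree reignite (x + 1) j).source.bind (fireNumber E reignite x)

/-- The right-most site burnt by fire number `k` (`⊤` if there is none). -/
noncomputable def rightmost (E : Environment) (reignite : Prop) (k : ℕ) : ℕ∞ :=
  ⨆ x : ℕ, ⨆ _ : ∃ j, E.fireNumber reignite x j = some k, (x : ℕ∞)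

/-- The duration of fire number `k` : the supremum of the times, counted from its start at site `0`,
at which it ignites a tree. -/
noncomputable def duration (E : Environment) (reignite : Prop) (k : ℕ) : ℝ≥0∞ :=
  ⨆ x : ℕ, ⨆ j : ℕ, ⨆ _ : E.fireNumber reignite x j = some k,
    ((E.tree reignite x j).time - (E.tree reignite 0 k).time)

/-- Fire number `k` burns arbitrarily distant sites and lasts for an infinite time. -/
def IsInfiniteFire (E : Environment) (reignite : Prop) (k : ℕ) : Prop :=
  E.rightmost reignite k = ⊤ ∧ E.duration reignite k = ⊤

end Environment

/-- The distribution of the random inputs: all waiting times `ξ x i`, burning times `θ x i` and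
delays `Δ x i` are independent; the waiting times are exponential with rate `1`, the burning times
have law `lawθ` and the delays have law `lawΔ`. -/
structure IsForestFireInput {Ω : Type*} [MeasurableSpace Ω] (P : Measure Ω)
    (lawθ lawΔ : Measure ℝ≥0) (ξ θ Δ : ℕ → ℕ → Ω → ℝ≥0) : Prop where
  growth_law : ∀ x i, HasLaw (fun ω => (ξ x i ω : ℝ)) (expMeasure 1) P
  burn_law : ∀ x i, HasLaw (θ x i) lawθ P
  delay_law : ∀ x i, HasLaw (Δ x i) lawΔ P
  indep : iIndepFun
    (Sum.elim (fun p => ξ p.1 p.2) (Sum.elim (fun p => θ p.1 p.2) (fun p => Δ p.1 p.2)) :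
      (ℕ × ℕ) ⊕ (ℕ × ℕ) ⊕ (ℕ × ℕ) → Ω → ℝ≥0) P

/-- The realisation of the inputs at the sample point `ω`. -/
def environment {Ω : Type*} (ξ θ Δ : ℕ → ℕ → Ω → ℝ≥0) (ω : Ω) : Environment :=
  ⟨fun x i => ξ x i ω, fun x i => θ x i ω, fun x i => Δ x i ω⟩

end ForestFire

/-!
A distant site burns for the first time only late, because fires spread with at most a finite speed.
By then its first tree has had a long time to grow, so the fire that arrives first does not stop.

Let `T x` be the time of the first burning of site `x`. Almost surely the waiting times at each
site have an infinite sum, so that the burnings of a site do not accumulate in time. As long as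
infinitely many of them take place, some arbitrarily late burnings end later than all previous
ones, and these are able to ignite whatever tree stands on the next site. By induction on the site
every tree burns (`Environment.time_ne_top`), so every `T x` is finite.

The first burning of `x + 1` is caused by the first burning of `x`, after its delay, or by a later
burning of `x`, which requires a second tree at `x`. Hence `T (x + 1)` exceeds `T x` by at least
`min (Δ x 0) (ξ x 1)` (`Environment.first_time_add_le`). These minima are independent and
identically distributed, and are not almost surely zero because `Δ` is not, so the strong law of
large numbers gives `c * x ≤ T x` for some `c > 0` and all large `x`
(`exists_linear_le_sum`). On the other hand `ξ (x + 1) 0 ≤ c * x` for all large `x` by the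
Borel–Cantelli lemma and the exponential tails (`ae_eventually_le_of_hasLaw_exp`).

Therefore, for all large `x`, the first tree of `x + 1` is present at time `T x`, and it is ignited
by the first burning of `x`. From some site on, all first burnings belong to the same fire, which
thus burns all these sites, and whose duration is infinite because `T x` tends to infinity
(`Environment.exists_isInfiniteFire`). The argument does not distinguish between the two
conventions on repeated ignitions.
-/

/-! ### Ignition of a tree by its left neighbour -/

namespace ForestFire

open Filter Topology

namespace Front

theorem le_fate_time (F : Front) (allowed : ℕ → Prop) (a : ℝ≥0∞) :
    a ≤ (F.fate allowed a).time := by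
  unfold fate
  split_ifs <;> simp

theorem time_le_cease (F : Front) (i : ℕ) : F.time i ≤ F.cease i :=
  le_self_add.trans le_self_add

theorem cease_ne_top {F : Front} (hfin : ∀ i, F.time i ≠ ⊤) (i : ℕ) : F.cease i ≠ ⊤ := by
  simp [cease, hfin]

theorem start_ne_top {F : Front} (hfin : ∀ i, F.time i ≠ ⊤) (i : ℕ) : F.start i ≠ ⊤ := by
  have hsum : ∑ j ∈ Finset.range i, F.cease j ≠ ⊤ :=
    ENNReal.sum_ne_top.2 fun j _ => cease_ne_top hfin j
  refine ne_top_of_le_ne_top (b := max (F.time i + F.delay i) (∑ j ∈ Finset.range i, F.cease j))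
    (by simp [hfin i, hsum]) (max_le_max le_rfl (iSup₂_le fun j hj => ?_))
  exact Finset.single_le_sum (f := F.cease) (fun _ _ => zero_le) (Finset.mem_range.2 hj)

/-- If the left neighbour burns at arbitrarily late times, then arbitrarily late burnings are able to
ignite a given tree: the first one that ends after a given time ends later than all earlier ones. -/
theorem exists_reaches {F : Front} (hfin : ∀ i, F.time i ≠ ⊤) (hF : Tendsto F.time atTop (𝓝 ⊤))
    {a : ℝ≥0∞} (ha : a ≠ ⊤) (N : ℕ) : ∃ i, N < i ∧ F.Reaches i a := by
  classical
  -- The burnings `0, …, N` all end by time `M`; the first one that ends later reaches the tree.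
  set M : ℝ≥0∞ := a + ∑ l ∈ Finset.range (N + 1), F.cease l with hM
  have hMtop : M < ⊤ := by
    simpa [hM, ha, lt_top_iff_ne_top] using fun l _ => cease_ne_top hfin l
  have hex : ∃ i, M < F.cease i := by
    obtain ⟨i, hi⟩ := (hF.eventually_const_lt hMtop).exists
    exact ⟨i, hi.trans_le (F.time_le_cease i)⟩
  have hlt := Nat.find_spec hex
  refine ⟨Nat.find hex, ?_, hfin _, fun j hj => ?_, Or.inr (le_self_add.trans_lt hlt)⟩
  · by_contra! hle
    have : F.cease (Nat.find hex) ≤ ∑ l ∈ Finset.range (N + 1), F.cease l :=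
      Finset.single_le_sum (f := F.cease) (fun _ _ => zero_le)
        (Finset.mem_range.2 (Nat.lt_succ_of_le hle))
    exact hlt.not_ge (this.trans le_add_self)
  · exact (not_lt.1 (Nat.find_min hex hj)).trans_lt hlt

theorem fate_time_ne_top {F : Front} (hfin : ∀ i, F.time i ≠ ⊤) {allowed : ℕ → Prop} {a : ℝ≥0∞}
    (ha : a ≠ ⊤) (h : ∃ i, allowed i ∧ F.Reaches i a) : (F.fate allowed a).time ≠ ⊤ := by
  simp [fate, h, ha, start_ne_top hfin]

theorem exists_fate_source {F : Front} {allowed : ℕ → Prop} {a : ℝ≥0∞}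
    (h : (F.fate allowed a).time ≠ ⊤) : ∃ i, (F.fate allowed a).source = some i := by
  unfold fate at h ⊢
  split_ifs with h' <;> simp_all

/-- A tree is not ignited before the delay of the burning responsible has elapsed. If no burning
ignites it, its time is `⊤` and any index serves. -/
theorem exists_add_delay_le_fate_time (F : Front) (allowed : ℕ → Prop) (a : ℝ≥0∞) :
    ∃ i, F.time i + F.delay i ≤ (F.fate allowed a).time := by
  unfold fate
  split_ifs with h
  · exact ⟨_, (le_max_left _ _).trans (le_max_right _ _)⟩
  · exact ⟨0, le_top⟩

/-- The first burning of the left neighbour has no predecessors, hence ignites every tree which is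
already present when it starts. -/
theorem fate_source_eq_zero {F : Front} {a : ℝ≥0∞} (h0 : F.time 0 ≠ ⊤) (ha : a ≤ F.time 0) :
    (F.fate (fun _ => True) a).source = some 0 := by
  have h : True ∧ F.Reaches 0 a :=
    ⟨trivial, h0, by simp, Or.inl ((ha.trans le_self_add).trans (le_max_left _ _))⟩
  have hex : ∃ i, True ∧ F.Reaches i a := ⟨0, h⟩
  classical
  unfold fate
  rw [dif_pos hex]
  simp only [Option.some.injEq, Nat.find_eq_zero]
  exact h

end Front

/-! ### The process in a fixed environment -/

namespace Environment

variable (E : Environment) (reignite : Prop)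

theorem growth_zero_le_time (x : ℕ) : (E.growth x 0 : ℝ≥0∞) ≤ (E.tree reignite x 0).time := by
  cases x with
  | zero => exact le_rfl
  | succ x => exact Front.le_fate_time _ _ _

theorem time_add_growth_le (x j : ℕ) :
    (E.tree reignite x j).time + E.growth x (j + 1) ≤ (E.tree reignite x (j + 1)).time := by
  have h : (E.tree reignite x j).time + E.growth x (j + 1) ≤
      (E.tree reignite x j).time + E.burn x j + E.growth x (j + 1) := by
    gcongr; exact le_self_add
  cases x with
  | zero => exact h
  | succ x => exact h.trans (Front.le_fate_time _ _ _)

theorem monotone_time (x : ℕ) : Monotone fun j => (E.tree reignite x j).time :=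
  monotone_nat_of_le_succ fun j => le_self_add.trans (E.time_add_growth_le reignite x j)

theorem sum_growth_le_time (x j : ℕ) :
    ∑ i ∈ Finset.range (j + 1), (E.growth x i : ℝ≥0∞) ≤ (E.tree reignite x j).time := by
  induction j with
  | zero => simpa using E.growth_zero_le_time reignite x
  | succ j ih =>
    rw [Finset.sum_range_succ]
    exact (add_le_add_left ih _).trans (E.time_add_growth_le reignite x j)

variable {E}

/-- The burnings of a site do not accumulate in time, since the `j`-th one is preceded by the waiting
times for `j + 1` trees. -/
theorem tendsto_time (hgrow : ∀ x, ∑' i, (E.growth x i : ℝ≥0∞) = ⊤) (x : ℕ) :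
    Tendsto (fun j => (E.tree reignite x j).time) atTop (𝓝 ⊤) := by
  have h := (ENNReal.tendsto_nat_tsum fun i => (E.growth x i : ℝ≥0∞)).comp (tendsto_add_atTop_nat 1)
  rw [hgrow x] at h
  exact tendsto_nhds_top_mono' h fun j => E.sum_growth_le_time reignite x j

/-- If no site grows infinitely many trees in a finite time, then every tree burns: each tree finds
late burnings of its left neighbour which are able and allowed to ignite it. -/
theorem time_ne_top (hgrow : ∀ x, ∑' i, (E.growth x i : ℝ≥0∞) = ⊤) (x j : ℕ) :
    (E.tree reignite x j).time ≠ ⊤ := by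
  induction x generalizing j with
  | zero =>
    induction j with
    | zero => exact ENNReal.coe_ne_top
    | succ j ih =>
      change (E.tree reignite 0 j).time + E.burn 0 j + E.growth 0 (j + 1) ≠ ⊤
      exact ENNReal.add_ne_top.2
        ⟨ENNReal.add_ne_top.2 ⟨ih, ENNReal.coe_ne_top⟩, ENNReal.coe_ne_top⟩
  | succ x ihx =>
    induction j with
    | zero =>
      obtain ⟨i, -, hi⟩ := Front.exists_reaches
        (F := ⟨fun i => (E.tree reignite x i).time, E.burn x, E.delay x⟩) ihx
        (tendsto_time reignite hgrow x) (ENNReal.coe_ne_top (r := E.growth (x + 1) 0)) 0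
      exact Front.fate_time_ne_top ihx ENNReal.coe_ne_top ⟨i, trivial, hi⟩
    | succ j ihj =>
      have ha : (E.tree reignite (x + 1) j).time + E.burn (x + 1) j + E.growth (x + 1) (j + 1) ≠ ⊤ :=
        ENNReal.add_ne_top.2 ⟨ENNReal.add_ne_top.2 ⟨ihj, ENNReal.coe_ne_top⟩, ENNReal.coe_ne_top⟩
      obtain ⟨i, hlt, hi⟩ := Front.exists_reaches
        (F := ⟨fun i => (E.tree reignite x i).time, E.burn x, E.delay x⟩) ihx
        (tendsto_time reignite hgrow x) ha ((E.tree reignite (x + 1) j).source.getD 0)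
      refine Front.fate_time_ne_top ihx ha ⟨i, Or.inr fun i' hi' => ?_, hi⟩
      have hs : (E.tree reignite (x + 1) j).source = some i' := hi'
      simpa [hs] using hlt

theorem exists_fireNumber_eq (hgrow : ∀ x, ∑' i, (E.growth x i : ℝ≥0∞) = ⊤) (x j : ℕ) :
    ∃ k, E.fireNumber reignite x j = some k := by
  induction x generalizing j with
  | zero => exact ⟨j, rfl⟩
  | succ x ih =>
    have h := time_ne_top reignite hgrow (x + 1) j
    obtain ⟨i, hi⟩ : ∃ i, (E.tree reignite (x + 1) j).source = some i := by
      cases j <;> exact Front.exists_fate_source h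
    obtain ⟨k, hk⟩ := ih i
    exact ⟨k, by simp [fireNumber, hi, hk]⟩

variable (E)

/-- The first burning of `x + 1` is caused either by the first burning of `x`, after its delay, or
by a later one, which takes place only after a second tree has grown at `x`. -/
theorem first_time_add_le (x : ℕ) :
    (E.tree reignite x 0).time + (min (E.delay x 0) (E.growth x 1) : ℝ≥0) ≤
      (E.tree reignite (x + 1) 0).time := by
  obtain ⟨i, hi⟩ := Front.exists_add_delay_le_fate_time
    ⟨fun i => (E.tree reignite x i).time, E.burn x, E.delay x⟩ (fun _ => True) (E.growth (x + 1) 0)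
  refine le_trans ?_ hi
  cases i with
  | zero => exact add_le_add_right (ENNReal.coe_le_coe.2 (min_le_left _ _)) _
  | succ i =>
    calc (E.tree reignite x 0).time + (min (E.delay x 0) (E.growth x 1) : ℝ≥0)
        ≤ (E.tree reignite x 0).time + E.growth x 1 :=
          add_le_add_right (ENNReal.coe_le_coe.2 (min_le_right _ _)) _
      _ ≤ (E.tree reignite x 1).time := E.time_add_growth_le reignite x 0
      _ ≤ (E.tree reignite x (i + 1)).time := E.monotone_time reignite x (by simp)
      _ ≤ _ := le_self_add

/-- The first burnings cannot travel to the right faster than the delays and the waiting times for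
second trees permit. The summands depend on disjoint sets of inputs for different sites. -/
theorem sum_min_le_first_time (x : ℕ) :
    ((∑ y ∈ Finset.range x, min (E.delay y 0) (E.growth y 1) : ℝ≥0) : ℝ≥0∞) ≤
      (E.tree reignite x 0).time := by
  induction x with
  | zero => simp
  | succ x ih =>
    rw [Finset.sum_range_succ, ENNReal.coe_add]
    exact (add_le_add_left ih _).trans (E.first_time_add_le reignite x)

variable {E}

/-- The deterministic criterion: if the first burnings travel with positive speed, and the first
trees grow earlier than that, then from some site on each first burning ignites the first tree of
the next site, so that all these burnings belong to one fire. -/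
theorem exists_isInfiniteFire (hgrow : ∀ x, ∑' i, (E.growth x i : ℝ≥0∞) = ⊤) {c : ℝ≥0} (hc : 0 < c)
    (hspeed : ∀ᶠ x : ℕ in atTop, c * x ≤ ∑ y ∈ Finset.range x, min (E.delay y 0) (E.growth y 1))
    (hfirst : ∀ᶠ x : ℕ in atTop, E.growth (x + 1) 0 ≤ c * x) :
    ∃ k, E.IsInfiniteFire reignite k := by
  have hT : ∀ᶠ x : ℕ in atTop, ((c * x : ℝ≥0) : ℝ≥0∞) ≤ (E.tree reignite x 0).time := by
    filter_upwards [hspeed] with x hx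
    exact (ENNReal.coe_le_coe.2 hx).trans (E.sum_min_le_first_time reignite x)
  obtain ⟨N, hN⟩ := eventually_atTop.1 (hT.and hfirst)
  obtain ⟨k, hk⟩ := exists_fireNumber_eq reignite hgrow N 0
  have hfire : ∀ x ≥ N, E.fireNumber reignite x 0 = some k := by
    intro x hx
    induction x, hx using Nat.le_induction with
    | base => exact hk
    | succ x hx ih =>
      have hs : (E.tree reignite (x + 1) 0).source = some 0 :=
        Front.fate_source_eq_zero (time_ne_top reignite hgrow x 0)
          ((ENNReal.coe_le_coe.2 (hN x hx).2).trans (hN x hx).1)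
      simp [fireNumber, hs, ih]
  refine ⟨k, ?_, ?_⟩
  · refine ENat.eq_top_iff_forall_ge.2 fun m => ?_
    refine le_trans ?_ (le_iSup₂_of_le (max m N) ⟨0, hfire _ (le_max_right _ _)⟩ le_rfl)
    exact_mod_cast le_max_left m N
  · have htend : Tendsto (fun x : ℕ => ((c * x : ℝ≥0) : ℝ≥0∞)) atTop (𝓝 ⊤) :=
      ENNReal.tendsto_coe_nhds_top.2 (tendsto_natCast_atTop_atTop.const_mul_atTop hc)
    refine ENNReal.eq_top_of_forall_nnreal_le fun r => ?_
    have hfin : (r : ℝ≥0∞) + (E.tree reignite 0 k).time < ⊤ :=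
      ENNReal.add_lt_top.2 ⟨ENNReal.coe_lt_top, (time_ne_top reignite hgrow 0 k).lt_top⟩
    obtain ⟨x, hx, hxN⟩ := ((htend.eventually_const_lt hfin).and (eventually_ge_atTop N)).exists
    refine le_trans ?_ (le_iSup_of_le x (le_iSup₂_of_le 0 (hfire x hxN) le_rfl))
    exact ENNReal.le_sub_of_add_le_right (time_ne_top reignite hgrow 0 k)
      (hx.le.trans (hN x hxN).1)

end Environment
/-! ### Limit theorems for independent inputs -/

/-- Sums of pairwise independent, identically distributed nonnegative variables which do not vanish
almost surely grow at least linearly. No integrability is needed, since the variables may be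
truncated at `1`. -/
theorem exists_linear_le_sum {Ω : Type*} [MeasurableSpace Ω] {P : Measure Ω}
    [IsProbabilityMeasure P] {Y : ℕ → Ω → ℝ≥0} (hindep : Pairwise fun i j => Y i ⟂ᵢ[P] Y j)
    (hident : ∀ i, IdentDistrib (Y i) (Y 0) P P) (hpos : ¬ ∀ᵐ ω ∂P, Y 0 ω = 0) :
    ∃ c : ℝ≥0, 0 < c ∧ ∀ᵐ ω ∂P, ∀ᶠ n : ℕ in atTop, c * n ≤ ∑ i ∈ Finset.range n, Y i ω := by
  let φ : ℝ≥0 → ℝ := fun y => min 1 (y : ℝ)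
  have hφ : Measurable φ := by fun_prop
  have hφ0 : ∀ y, 0 ≤ φ y := fun y => le_min zero_le_one y.2
  have hint : Integrable (φ ∘ Y 0) P := by
    refine Integrable.of_bound
      (hφ.comp_aemeasurable (hident 0).aemeasurable_fst).aestronglyMeasurable 1
      (Eventually.of_forall fun ω => ?_)
    exact (Real.norm_of_nonneg (hφ0 _)).trans_le (min_le_left _ _)
  have hlaw := strong_law_ae_real (fun i => φ ∘ Y i) hint
    (fun i j hij => (hindep hij).comp hφ hφ) fun i => (hident i).comp hφ
  have hmean : 0 < P[φ ∘ Y 0] := by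
    refine (integral_nonneg fun ω => hφ0 _).lt_of_ne fun h => hpos ?_
    filter_upwards [(integral_eq_zero_iff_of_nonneg (fun ω => hφ0 _) hint).1 h.symm] with ω hω
    have h1 : min 1 (Y 0 ω : ℝ) = 0 := hω
    rcases min_choice 1 (Y 0 ω : ℝ) with h2 | h2
    · exact absurd (h2.symm.trans h1) one_ne_zero
    · exact_mod_cast h2.symm.trans h1
  obtain ⟨c, hc0, hc⟩ := exists_between hmean
  lift c to ℝ≥0 using hc0.le
  refine ⟨c, by exact_mod_cast hc0, ?_⟩
  filter_upwards [hlaw] with ω hω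
  filter_upwards [hω.eventually_const_lt hc, eventually_gt_atTop 0] with n hn hn0
  rw [lt_div_iff₀ (by exact_mod_cast hn0)] at hn
  rw [← NNReal.coe_le_coe]
  push_cast
  exact hn.le.trans (Finset.sum_le_sum fun i _ => min_le_right _ _)

theorem expMeasure_Ioi {t : ℝ} (ht : 0 ≤ t) :
    expMeasure 1 (Set.Ioi t) = ENNReal.ofReal (Real.exp (-t)) := by
  have : IsProbabilityMeasure (expMeasure 1) := isProbabilityMeasure_expMeasure one_pos
  rw [← Set.compl_Iic, ← ofReal_measureReal, probReal_compl_eq_one_sub measurableSet_Iic,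
    ← cdf_eq_real, cdf_expMeasure_eq one_pos, if_pos ht]
  simp

/-- Variables with exponential tails are eventually below any linear function, by Borel–Cantelli;
independence plays no role. -/
theorem ae_eventually_le_of_hasLaw_exp {Ω : Type*} [MeasurableSpace Ω] {P : Measure Ω}
    {Z : ℕ → Ω → ℝ≥0} (hZ : ∀ n, HasLaw (fun ω => (Z n ω : ℝ)) (expMeasure 1) P)
    {c : ℝ≥0} (hc : 0 < c) : ∀ᵐ ω ∂P, ∀ᶠ n : ℕ in atTop, Z n ω ≤ c * n := by
  have hmeas : ∀ n : ℕ, P {ω | (c * n : ℝ) < Z n ω} = ENNReal.ofReal (Real.exp (n * -c)) := by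
    intro n
    rw [(hZ n).measure_eq (p := fun z => (c * n : ℝ) < z) measurableSet_Ioi]
    exact (expMeasure_Ioi (by positivity)).trans (by ring_nf)
  have hsum : Summable fun n : ℕ => Real.exp (n * -c) :=
    Real.summable_exp_nat_mul_iff.2 (by simpa using hc)
  have htop : ∑' n : ℕ, P {ω | (c * n : ℝ) < Z n ω} ≠ ⊤ := by
    simp_rw [hmeas]
    exact hsum.tsum_ofReal_ne_top
  filter_upwards [ae_eventually_notMem htop] with ω hω
  filter_upwards [hω] with n hn
  exact_mod_cast not_lt.1 hn

theorem ae_pos_of_hasLaw_exp {Ω : Type*} [MeasurableSpace Ω] {P : Measure Ω}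
    {Z : Ω → ℝ≥0} (hZ : HasLaw (fun ω => (Z ω : ℝ)) (expMeasure 1) P) : ∀ᵐ ω ∂P, 0 < Z ω := by
  have : IsProbabilityMeasure (expMeasure 1) := isProbabilityMeasure_expMeasure one_pos
  have h : ∀ᵐ z ∂expMeasure 1, z ∈ Set.Ioi (0 : ℝ) := by
    refine (mem_ae_iff_prob_eq_one measurableSet_Ioi).2 ?_
    rw [expMeasure_Ioi le_rfl]
    simp
  rw [← hZ.map_eq] at h
  filter_upwards [ae_of_ae_map hZ.aemeasurable h] with ω hω
  exact_mod_cast hω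

theorem identDistrib_of_hasLaw_coe {Ω : Type*} [MeasurableSpace Ω] {P : Measure Ω}
    {Z Z' : Ω → ℝ≥0} {μ : Measure ℝ} (hZ : HasLaw (fun ω => (Z ω : ℝ)) μ P)
    (hZ' : HasLaw (fun ω => (Z' ω : ℝ)) μ P) : IdentDistrib Z Z' P P := by
  have h : IdentDistrib (fun ω => (Z ω : ℝ)) (fun ω => (Z' ω : ℝ)) P P :=
    ⟨hZ.aemeasurable, hZ'.aemeasurable, hZ.map_eq.trans hZ'.map_eq.symm⟩
  have := h.comp measurable_real_toNNReal
  simpa only [Function.comp_def, Real.toNNReal_coe] using this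

/-! ### The random inputs -/

namespace IsForestFireInput

variable {Ω : Type*} [MeasurableSpace Ω] {P : Measure Ω} {lawθ lawΔ : Measure ℝ≥0}
  {ξ θ Δ : ℕ → ℕ → Ω → ℝ≥0}

theorem identDistrib_growth (h : IsForestFireInput P lawθ lawΔ ξ θ Δ) (x i y j : ℕ) :
    IdentDistrib (ξ x i) (ξ y j) P P :=
  identDistrib_of_hasLaw_coe (h.growth_law x i) (h.growth_law y j)

theorem identDistrib_delay (h : IsForestFireInput P lawθ lawΔ ξ θ Δ) (x i y j : ℕ) :
    IdentDistrib (Δ x i) (Δ y j) P P :=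
  ⟨(h.delay_law x i).aemeasurable, (h.delay_law y j).aemeasurable,
    (h.delay_law x i).map_eq.trans (h.delay_law y j).map_eq.symm⟩

theorem ae_tsum_growth_eq_top [IsProbabilityMeasure P]
    (h : IsForestFireInput P lawθ lawΔ ξ θ Δ) (x : ℕ) :
    ∀ᵐ ω ∂P, ∑' i, (ξ x i ω : ℝ≥0∞) = ⊤ := by
  obtain ⟨c, hc, hlin⟩ := exists_linear_le_sum (P := P) (Y := ξ x)
    (fun i j hij => h.indep.indepFun (i := Sum.inl (x, i)) (j := Sum.inl (x, j)) (by simp [hij]))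
    (fun i => h.identDistrib_growth x i x 0)
    (fun h0 => by
      obtain ⟨ω, hω, hω'⟩ := (h0.and (ae_pos_of_hasLaw_exp (h.growth_law x 0))).exists
      exact hω'.ne' hω)
  filter_upwards [hlin] with ω hω
  have htend : Tendsto (fun n : ℕ => ((c * n : ℝ≥0) : ℝ≥0∞)) atTop (𝓝 ⊤) :=
    ENNReal.tendsto_coe_nhds_top.2 (tendsto_natCast_atTop_atTop.const_mul_atTop hc)
  refine tendsto_nhds_unique (ENNReal.tendsto_nat_tsum fun i => (ξ x i ω : ℝ≥0∞))
    (tendsto_nhds_top_mono htend ?_)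
  filter_upwards [hω] with n hn
  exact_mod_cast hn

theorem exists_linear_le_sum_min [IsProbabilityMeasure P]
    (h : IsForestFireInput P lawθ lawΔ ξ θ Δ)
    (hΔ : 0 < lawΔ (Set.Ioi 0)) : ∃ c : ℝ≥0, 0 < c ∧ ∀ᵐ ω ∂P, ∀ᶠ n : ℕ in atTop,
      c * n ≤ ∑ x ∈ Finset.range n, min (Δ x 0 ω) (ξ x 1 ω) := by
  have haem : ∀ s, AEMeasurable ((Sum.elim (fun p => ξ p.1 p.2)
      (Sum.elim (fun p => θ p.1 p.2) (fun p => Δ p.1 p.2)) :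
        (ℕ × ℕ) ⊕ (ℕ × ℕ) ⊕ (ℕ × ℕ) → Ω → ℝ≥0) s) P := by
    rintro (⟨x, i⟩ | ⟨x, i⟩ | ⟨x, i⟩)
    · exact (h.identDistrib_growth x i x i).aemeasurable_fst
    · exact (h.burn_law x i).aemeasurable
    · exact (h.delay_law x i).aemeasurable
  have hmin : Measurable fun p : ℝ≥0 × ℝ≥0 => min p.1 p.2 := measurable_fst.min measurable_snd
  refine exists_linear_le_sum (P := P) (Y := fun x ω => min (Δ x 0 ω) (ξ x 1 ω))
    (fun x y hxy => ?_) (fun x => ?_) (fun h0 => ?_)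
  · exact (h.indep.indepFun_prodMk_prodMk₀ haem (Sum.inr (Sum.inr (x, 0))) (Sum.inl (x, 1))
      (Sum.inr (Sum.inr (y, 0))) (Sum.inl (y, 1)) (by simpa using hxy) (by simp) (by simp)
      (by simpa using hxy)).comp hmin hmin
  · have hi : ∀ z, Δ z 0 ⟂ᵢ[P] ξ z 1 := fun z =>
      h.indep.indepFun (i := Sum.inr (Sum.inr (z, 0))) (j := Sum.inl (z, 1)) (by simp)
    exact ((h.identDistrib_delay x 0 0 0).prodMk (h.identDistrib_growth x 1 0 1)
      (hi x) (hi 0)).comp hmin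
  · have hzero : ∀ᵐ ω ∂P, ¬ 0 < Δ 0 0 ω := by
      filter_upwards [h0, ae_pos_of_hasLaw_exp (h.growth_law 0 1)] with ω hω hξ hpos
      exact (lt_min hpos hξ).ne' hω
    have hP : P {ω | 0 < Δ 0 0 ω} = 0 := by simpa [ae_iff, pos_iff_ne_zero] using hzero
    rw [(h.delay_law 0 0).measure_eq (p := fun d => 0 < d) measurableSet_Ioi] at hP
    exact hΔ.ne' hP

end IsForestFireInput

end ForestFire

/-- If the spreading delays are not almost surely zero, then almost surely there is an infinite
fire, whether or not a single burning of a site may ignite its right neighbour repeatedly. -/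
theorem mainTheorem1 {Ω : Type*} [MeasurableSpace Ω] (P : Measure Ω) [IsProbabilityMeasure P]
    (lawθ lawΔ : Measure ℝ≥0) [IsProbabilityMeasure lawθ] [IsProbabilityMeasure lawΔ]
    (ξ θ Δ : ℕ → ℕ → Ω → ℝ≥0) (hinput : ForestFire.IsForestFireInput P lawθ lawΔ ξ θ Δ)
    (hΔ : 0 < lawΔ (Set.Ioi 0)) (reignite : Prop) :
    (∀ᵐ ω ∂P, sInf ((fun k : ℕ => (k : ℕ∞)) ''
        {k : ℕ | (ForestFire.environment ξ θ Δ ω).rightmost reignite k = ⊤}) < ⊤) ∧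
      ∀ᵐ ω ∂P, ∃ k : ℕ, (ForestFire.environment ξ θ Δ ω).IsInfiniteFire reignite k := by
  have hfire : ∀ᵐ ω ∂P, ∃ k : ℕ, (ForestFire.environment ξ θ Δ ω).IsInfiniteFire reignite k := by
    obtain ⟨c, hc, hspeed⟩ := hinput.exists_linear_le_sum_min hΔ
    filter_upwards [ae_all_iff.2 hinput.ae_tsum_growth_eq_top, hspeed,
      ForestFire.ae_eventually_le_of_hasLaw_exp (fun x => hinput.growth_law (x + 1) 0) hc]
      with ω hgrow hspeed hfirst
    exact ForestFire.Environment.exists_isInfiniteFire reignite hgrow hc hspeed hfirst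
  refine ⟨?_, hfire⟩
  filter_upwards [hfire] with ω ⟨k, hk⟩
  exact lt_of_le_of_lt (sInf_le ⟨k, hk.1, rfl⟩) (ENat.natCast_lt_top k)
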